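/- Let $\mathbb T=\mathbb R$ or $\mathbb T=\mathbb R_+=[0,+\infty)$, and let $f\in C(\mathbb T\times\mathbb R,\mathbb R)$. Suppose that: 1. $f$ is positively regular: for every $g\in H^+(f)$ and every $v\in\mathbb R$ the equation $x'=g(t,x)$ has a unique solution on $\mathbb R_+$ with value $v$ at $t=0$, where $H^+(f)$ is the closure, in the compact-open topology of $C(\mathbb T\times\mathbb R,\mathbb R)$, of the set of translates $f^h(t,x):=f(t+h,x)$, $h\ge 0$; 2. $f$ is monotone in $x$: if $x_1\le x_2$ then $f(t,x_1)\le f(t,x_2)$ for all $t\in\mathbb T$; 3. $f$ is asymptotically almost periodic in $t$ uniformly with respect to $x$ on compact sets: there are $p,r\in C(\mathbb R\times\mathbb R,\mathbb R)$ with $f=p+r$ on $\mathbb T\times\mathbb R$ such that, for every compact $K\subset\mathbb R$, $\sup_{x\in K}|r(t,x)|\to0$ as $t\to+\infty$, and for every $\varepsilon>0$ there is $l>0$ such that every segment $[a,a+l]$ contains a $\tau$ with $|p(t+\tau,x)-p(t,x)|<\varepsilon$ for all $t\in\mathbb R$, $x\in K$. Then every solution $\varphi$ of $x'=f(t,x)$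 on $\mathbb R_+$ that is bounded on $\mathbb R_+$ is remotely almost periodic: for every $\varepsilon>0$ there is $l>0$ such that every segment $[a,a+l]$ contains a $\tau$ for which there is $L=L(\varepsilon,\tau)>0$ with $|\varphi(t+\tau)-\varphi(t)|<\varepsilon$ for all $t\ge L$. Moreover, if in 3. the function $p$ is $\tau$-periodic in $t$ for some $\tau>0$ (respectively, independent of $t$) instead of almost periodic, then every such $\varphi$ satisfies $\lim_{t\to+\infty}|\varphi(t+\tau)-\varphi(t)|=0$ for this $\tau$ (respectively, for every $\tau\in\mathbb R$). -/

import Mathlib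

open Set Filter Topology

/-- `g` is the translate `f^h`, `f^h (t, x) = f (t + h, x)`. The time axis `T` is `ℝ` or `[0, ∞)`
and `h ≥ 0`, so that `t + h` lies in `T` for every `t` in `T`. -/
def IsTranslate {T : Set ℝ} (f : C(T × ℝ, ℝ)) (h : ℝ) (g : C(T × ℝ, ℝ)) : Prop :=
  ∀ s t : T, (s : ℝ) = (t : ℝ) + h → ∀ x : ℝ, g (t, x) = f (s, x)

/-- The positive hull `H⁺(f)`: the closure, in the compact-open topology, of the set of the
translates `f^h` with `h ≥ 0`. -/
def positiveHull {T : Set ℝ} (f : C(T × ℝ, ℝ)) : Set C(T × ℝ, ℝ) :=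
  closure {g | ∃ h : ℝ, 0 ≤ h ∧ IsTranslate f h g}

/-- `φ` restricted to `[0, ∞)` solves `x' = g (t, x)` there (one-sided derivative at `0`).
The values of `φ` on the negative axis play no role. -/
def IsSolutionOnHalfLine {T : Set ℝ} (g : C(T × ℝ, ℝ)) (φ : ℝ → ℝ) : Prop :=
  ∀ t : T, 0 ≤ (t : ℝ) → HasDerivWithinAt φ (g (t, φ t)) (Ici 0) (t : ℝ)

/-- For every `g ∈ H⁺(f)` and every `v`, the equation `x' = g (t, x)` has a unique solution
on `[0, ∞)` with value `v` at time `0`. -/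
def PositivelyRegular {T : Set ℝ} (f : C(T × ℝ, ℝ)) : Prop :=
  ∀ g ∈ positiveHull f, ∀ v : ℝ,
    (∃ φ : ℝ → ℝ, IsSolutionOnHalfLine g φ ∧ φ 0 = v) ∧
    ∀ φ ψ : ℝ → ℝ, IsSolutionOnHalfLine g φ → IsSolutionOnHalfLine g ψ →
      φ 0 = v → ψ 0 = v → EqOn φ ψ (Ici 0)

/-- Order-preserving in `x`, for every `t`. -/
def MonotoneInSpace {T : Set ℝ} (f : C(T × ℝ, ℝ)) : Prop :=
  ∀ (t : T) (x₁ x₂ : ℝ), x₁ ≤ x₂ → f (t, x₁) ≤ f (t, x₂)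

/-- Almost periodic in `t` uniformly with respect to `x` on every compact set. -/
def AlmostPeriodicInTime (p : C(ℝ × ℝ, ℝ)) : Prop :=
  ∀ K : Set ℝ, IsCompact K → ∀ ε : ℝ, 0 < ε → ∃ l : ℝ, 0 < l ∧ ∀ a : ℝ, ∃ τ ∈ Icc a (a + l),
    ∀ t : ℝ, ∀ x ∈ K, |p (t + τ, x) - p (t, x)| < ε

def PeriodicInTime (τ : ℝ) (p : C(ℝ × ℝ, ℝ)) : Prop :=
  ∀ t x : ℝ, p (t + τ, x) = p (t, x)

def StationaryInTime (p : C(ℝ × ℝ, ℝ)) : Prop :=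
  ∀ τ : ℝ, PeriodicInTime τ p

/-- `f = p + r` on `T × ℝ`, where `p` has the property `P` and `r (t, x) → 0` as `t → +∞`,
uniformly with respect to `x` on every compact set. -/
def AsymptoticallyInTime (P : C(ℝ × ℝ, ℝ) → Prop) {T : Set ℝ} (f : C(T × ℝ, ℝ)) : Prop :=
  ∃ p r : C(ℝ × ℝ, ℝ),
    (∀ (t : T) (x : ℝ), f (t, x) = p ((t : ℝ), x) + r ((t : ℝ), x)) ∧
    P p ∧
    ∀ K : Set ℝ, IsCompact K →
      TendstoUniformlyOn (fun t x : ℝ => r (t, x)) (fun _ => 0) atTop K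

/-- For every `ε > 0` there is `l > 0` such that every segment `[a, a + l]` contains a `τ` with
`|φ (t + τ) - φ t| < ε` for all `t ≥ L (ε, τ)`. As `L` may be enlarged, only the values
of `φ` near `+∞` matter. -/
def RemotelyAlmostPeriodic (φ : ℝ → ℝ) : Prop :=
  ∀ ε : ℝ, 0 < ε → ∃ l : ℝ, 0 < l ∧ ∀ a : ℝ, ∃ τ ∈ Icc a (a + l),
    ∃ L : ℝ, 0 < L ∧ ∀ t : ℝ, L ≤ t → |φ (t + τ) - φ t| < ε

def RemotelyPeriodic (τ : ℝ) (φ : ℝ → ℝ) : Prop :=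
  Tendsto (fun t => |φ (t + τ) - φ t|) atTop (𝓝 0)

def RemotelyStationary (φ : ℝ → ℝ) : Prop :=
  ∀ τ : ℝ, RemotelyPeriodic τ φ

/-! If `t₁ - t₂` is a good almost period of `p` and both times are late, then by monotonicity in `x`
the difference `φ (t₁ + s) - φ (t₂ + s)` can hardly decrease while it is nonnegative
(`SeparatesTranslates`). Let `D` be the asymptotic supremum of such differences. By relative density
of almost periods, a nearly extremal pair can be carried forward to any prescribed phase at little
loss (`exists_asymptotic_oscillation`).

Given a late `t`, take a nearly extremal pair `t₁, t₂` in phase with `t`. If an almost period `τ`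
raised `φ` appreciably from `t` to `t + τ`, then `φ t₁ - φ t` would nearly persist, so `φ (t₁ + τ) -
φ t₂` would exceed `D`; a drop is excluded symmetrically with `t₂`. Hence good almost periods of `p`
are eventually almost periods of `φ`. -/

/-- `τ` is a `δ`-almost period of `p (·, x)`, uniformly with respect to `x ∈ K`. -/
def IsAlmostPeriodOn (p : C(ℝ × ℝ, ℝ)) (K : Set ℝ) (δ τ : ℝ) : Prop :=
  ∀ t : ℝ, ∀ x ∈ K, |p (t + τ, x) - p (t, x)| < δ

namespace IsAlmostPeriodOn

variable {p : C(ℝ × ℝ, ℝ)} {K : Set ℝ} {δ δ' τ τ' : ℝ}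

theorem mono (h : IsAlmostPeriodOn p K δ τ) (hδ : δ ≤ δ') : IsAlmostPeriodOn p K δ' τ :=
  fun t x hx => (h t x hx).trans_le hδ

theorem zero (hδ : 0 < δ) : IsAlmostPeriodOn p K δ 0 := fun t x _ => by simpa using hδ

theorem neg (h : IsAlmostPeriodOn p K δ τ) : IsAlmostPeriodOn p K δ (-τ) := fun t x hx => by
  have := h (t + -τ) x hx
  rwa [neg_add_cancel_right, abs_sub_comm] at this

theorem add (h : IsAlmostPeriodOn p K δ τ) (h' : IsAlmostPeriodOn p K δ' τ') :
    IsAlmostPeriodOn p K (δ + δ') (τ + τ') := fun t x hx => by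
  have h₁ := h' (t + τ) x hx
  have h₂ := h t x hx
  rw [← add_assoc]
  rw [abs_lt] at *
  constructor <;> linarith

end IsAlmostPeriodOn

theorem PeriodicInTime.int_mul {p : C(ℝ × ℝ, ℝ)} {τ : ℝ} (hp : PeriodicInTime τ p) (n : ℤ) :
    PeriodicInTime (n * τ) p := fun t x =>
  Function.Periodic.int_mul (f := fun t => p (t, x)) (fun t => hp t x) n t

theorem PeriodicInTime.almostPeriodicInTime {p : C(ℝ × ℝ, ℝ)} {τ : ℝ} (hτ : 0 < τ)
    (hp : PeriodicInTime τ p) : AlmostPeriodicInTime p := by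
  intro K _ ε hε
  refine ⟨τ, hτ, fun a => ⟨⌈a / τ⌉ * τ, ⟨?_, ?_⟩, fun t x _ => ?_⟩⟩
  · exact (div_le_iff₀ hτ).1 (Int.le_ceil _)
  · have := (Int.ceil_lt_add_one (a / τ)).le
    calc (⌈a / τ⌉ : ℝ) * τ ≤ (a / τ + 1) * τ := by gcongr
      _ = a + τ := by field_simp
  · simpa [hp.int_mul _ t x] using hε

theorem PeriodicInTime.isAlmostPeriodOn {p : C(ℝ × ℝ, ℝ)} {τ : ℝ} (hp : PeriodicInTime τ p)
    (K : Set ℝ) {δ : ℝ} (hδ : 0 < δ) : IsAlmostPeriodOn p K δ τ := fun t x _ => by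
  simpa [hp t x] using hδ

/-- A function whose derivative exceeds `-γ` wherever the function is nonnegative decreases at
rate at most `γ` as long as this bound is nonnegative. -/
theorem sub_mul_le_of_neg_lt_deriv {d d' : ℝ → ℝ} {γ h : ℝ} (hγ : 0 < γ) (hh : 0 ≤ h)
    (hd : ∀ s ∈ Icc 0 h, HasDerivWithinAt d (d' s) (Ici 0) s)
    (hd' : ∀ s ∈ Icc 0 h, 0 ≤ d s → -γ < d' s) (h0 : γ * h ≤ d 0) : d 0 - γ * h ≤ d h := by
  have key := image_le_of_deriv_right_lt_deriv_boundary (f := fun s => -d s)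
    (f' := fun s => -d' s) (a := 0) (b := h) (B := fun s => γ * s - d 0) (B' := fun _ => γ)
    (fun s hs => ((hd s hs).neg.continuousWithinAt).mono Icc_subset_Ici_self)
    (fun s hs => ((hd s (Ico_subset_Icc_self hs)).neg).mono (Ici_subset_Ici.2 hs.1))
    (by simp)
    (fun s => by simpa using ((hasDerivAt_id s).const_mul γ).sub_const (d 0))
    -- Where `-d` meets the barrier, `d s = d 0 - γ * s ≥ 0`, so the derivative bound is available
    -- exactly there.
    (fun s hs heq => by
      have h1 : γ * s ≤ γ * h := by gcongr; exact hs.2.le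
      have := hd' s (Ico_subset_Icc_self hs) (by linarith)
      linarith)
    (right_mem_Icc.2 hh)
  linarith

/-- `φ` separates in time from its own translates: at late times with nearly the same phase,
`φ t₁ - φ t₂` decreases along the translates at an arbitrarily small rate only. -/
def SeparatesTranslates (p : C(ℝ × ℝ, ℝ)) (K : Set ℝ) (φ : ℝ → ℝ) : Prop :=
  ∀ γ : ℝ, 0 < γ → ∃ δ : ℝ, 0 < δ ∧ ∀ t₁ t₂ : ℝ, δ⁻¹ ≤ t₁ → δ⁻¹ ≤ t₂ →
    IsAlmostPeriodOn p K δ (t₁ - t₂) → ∀ h : ℝ, 0 ≤ h → γ * h ≤ φ t₁ - φ t₂ →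
      φ t₁ - φ t₂ - γ * h ≤ φ (t₁ + h) - φ (t₂ + h)

theorem IsSolutionOnHalfLine.separatesTranslates {T : Set ℝ} (hT : Ici 0 ⊆ T)
    {f : C(T × ℝ, ℝ)} (hmono : MonotoneInSpace f) {φ : ℝ → ℝ} (hφ : IsSolutionOnHalfLine f φ)
    {K : Set ℝ} (hK : ∀ t : ℝ, 0 ≤ t → φ t ∈ K) {p r : C(ℝ × ℝ, ℝ)}
    (hf : ∀ (t : T) (x : ℝ), f (t, x) = p ((t : ℝ), x) + r ((t : ℝ), x))
    (hr : TendstoUniformlyOn (fun t x : ℝ => r (t, x)) (fun _ => 0) atTop K) :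
    SeparatesTranslates p K φ := by
  intro γ hγ
  obtain ⟨L, hL⟩ := eventually_atTop.1 (Metric.tendstoUniformlyOn_iff.1 hr (γ / 3) (by linarith))
  have hr' : ∀ t x, L ≤ t → x ∈ K → |r (t, x)| < γ / 3 := fun t x ht hx => by
    simpa using hL t ht x hx
  -- The almost period and the two values of `r` each cost `γ / 3`; the second entry forces both
  -- times past `L` and `0`.
  have hδ : 0 < min (γ / 3) (|L| + 1)⁻¹ := by positivity
  refine ⟨min (γ / 3) (|L| + 1)⁻¹, hδ, fun t₁ t₂ h₁ h₂ hp h hh h0 => ?_⟩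
  have hle : |L| + 1 ≤ (min (γ / 3) (|L| + 1)⁻¹)⁻¹ := by
    rw [le_inv_comm₀ (by positivity) hδ]
    exact min_le_right _ _
  have hLabs := le_abs_self L
  have hL0 := abs_nonneg L
  have hder : ∀ t (ht : 0 ≤ t) s, s ∈ Icc 0 h →
      HasDerivWithinAt (fun s => φ (t + s)) (p (t + s, φ (t + s)) + r (t + s, φ (t + s)))
        (Ici 0) s := by
    intro t ht s hs
    have h1 := hφ ⟨t + s, hT (add_nonneg ht hs.1)⟩ (add_nonneg ht hs.1)
    rw [hf] at h1
    have h2 : HasDerivWithinAt (fun s => t + s) 1 (Ici 0) s :=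
      ((hasDerivAt_id s).const_add t).hasDerivWithinAt
    exact (h1.comp s h2 fun u hu => add_nonneg ht hu).congr_deriv (mul_one _)
  have key := sub_mul_le_of_neg_lt_deriv (d := fun s => φ (t₁ + s) - φ (t₂ + s))
    hγ hh (fun s hs => (hder t₁ (by linarith) s hs).sub (hder t₂ (by linarith) s hs))
    (fun s hs hd => ?_) (by simpa using h0)
  · simpa using key
  · have hx := hK (t₁ + s) (by linarith [hs.1])
    have hy := hK (t₂ + s) (by linarith [hs.1])
    have e1 := hp (t₂ + s) _ hx
    rw [show t₂ + s + (t₁ - t₂) = t₁ + s by ring] at e1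
    have e1 := abs_lt.1 (e1.trans_le (min_le_left _ _))
    have e2 := abs_lt.1 (hr' (t₁ + s) _ (by linarith [hs.1]) hx)
    have e3 := abs_lt.1 (hr' (t₂ + s) _ (by linarith [hs.1]) hx)
    have e4 := hmono ⟨t₂ + s, hT (show (0 : ℝ) ≤ t₂ + s by linarith [hs.1])⟩ _ _
      (sub_nonneg.1 hd)
    simp only [hf] at e4
    linarith [e1.1, e2.1, e3.2]

/-- The asymptotic oscillation `D` of `φ` over times of nearly the same phase: it bounds the
oscillation from above, and it is nearly attained at every phase. -/
theorem exists_asymptotic_oscillation {p : C(ℝ × ℝ, ℝ)} {K : Set ℝ} {φ : ℝ → ℝ}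
    (hp : ∀ δ : ℝ, 0 < δ → ∃ l : ℝ, 0 < l ∧ ∀ a : ℝ, ∃ τ ∈ Icc a (a + l),
      IsAlmostPeriodOn p K δ τ)
    (hbdd : ∃ C : ℝ, ∀ t : ℝ, 0 ≤ t → |φ t| ≤ C) (hφ : SeparatesTranslates p K φ) :
    ∃ D : ℝ,
      (∀ η : ℝ, 0 < η → ∃ δ : ℝ, 0 < δ ∧ ∀ t₁ t₂ : ℝ, δ⁻¹ ≤ t₁ → δ⁻¹ ≤ t₂ →
        IsAlmostPeriodOn p K δ (t₁ - t₂) → φ t₁ - φ t₂ ≤ D + η) ∧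
      ∀ η : ℝ, 0 < η → ∀ δ : ℝ, 0 < δ → ∀ t : ℝ, ∃ t₁ t₂ : ℝ, δ⁻¹ ≤ t₁ ∧ δ⁻¹ ≤ t₂ ∧
        IsAlmostPeriodOn p K δ (t₁ - t) ∧ IsAlmostPeriodOn p K δ (t₂ - t) ∧
          D - η ≤ φ t₁ - φ t₂ := by
  obtain ⟨C, hC⟩ := hbdd
  -- `A` collects the eventual upper bounds of the oscillation
  let A : Set ℝ := {d | ∃ δ : ℝ, 0 < δ ∧ ∀ t₁ t₂ : ℝ, δ⁻¹ ≤ t₁ → δ⁻¹ ≤ t₂ →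
    IsAlmostPeriodOn p K δ (t₁ - t₂) → φ t₁ - φ t₂ ≤ d}
  have hA : A.Nonempty := ⟨2 * C, 1, one_pos, fun t₁ t₂ h₁ h₂ _ => by
    have e1 := abs_le.1 (hC t₁ (by norm_num at h₁; linarith))
    have e2 := abs_le.1 (hC t₂ (by norm_num at h₂; linarith))
    linarith [e1.2, e2.1]⟩
  have hA0 : ∀ d ∈ A, 0 ≤ d := by
    rintro d ⟨δ, hδ, h⟩
    simpa using h δ⁻¹ δ⁻¹ le_rfl le_rfl (by simpa using IsAlmostPeriodOn.zero hδ)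
  have hAb : BddBelow A := ⟨0, hA0⟩
  refine ⟨sInf A, fun η hη => ?_, fun η hη δ hδ t => ?_⟩
  · obtain ⟨d, ⟨δ, hδ, h⟩, hd⟩ := exists_lt_of_csInf_lt hA (lt_add_of_pos_right (sInf A) hη)
    exact ⟨δ, hδ, fun t₁ t₂ h₁ h₂ h₃ => (h t₁ t₂ h₁ h₂ h₃).trans hd.le⟩
  · obtain ⟨l, hl, hrd⟩ := hp (δ / 2) (by linarith)
    -- If `D ≤ η`, the trivial pair `t₁ = t₂` suffices. Otherwise the difference stays positive
    -- during the shift, as separation requires.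
    rcases le_or_gt (sInf A) η with hsmall | hbig
    · obtain ⟨τ, hτ, hτp⟩ := hrd (δ⁻¹ - t)
      have hτ' : IsAlmostPeriodOn p K δ (t + τ - t) := by
        rw [add_sub_cancel_left]
        exact hτp.mono (by linarith)
      exact ⟨t + τ, t + τ, by linarith [hτ.1], by linarith [hτ.1], hτ', hτ', by linarith⟩
    -- The shift to the phase of `t` takes time at most `l`, so this rate loses at most `η / 2`.
    · obtain ⟨δ₁, hδ₁, hsep⟩ := hφ (η / 2 / l) (by positivity)
      have hδ₂ : 0 < min δ₁ (δ / 2) := by positivity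
      have hnot : sInf A - η / 2 ∉ A := fun h => by linarith [csInf_le hAb h]
      simp only [A, mem_ofPred_eq, not_exists, not_and, not_forall, not_le] at hnot
      obtain ⟨t₁, t₂, h₁, h₂, h₁₂, hosc⟩ := hnot _ hδ₂
      have i1 : δ₁⁻¹ ≤ (min δ₁ (δ / 2))⁻¹ := inv_anti₀ hδ₂ (min_le_left _ _)
      have i2 : δ⁻¹ ≤ (min δ₁ (δ / 2))⁻¹ :=
        inv_anti₀ hδ₂ ((min_le_right _ _).trans (by linarith))
      -- Shifting both times by `t + τ - t₁ ∈ [0, l]` takes `t₁` to `t + τ`.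
      obtain ⟨τ, hτ, hτp⟩ := hrd (t₁ - t)
      have hτ0 : 0 ≤ t + τ - t₁ := by linarith [hτ.1]
      have hγ : η / 2 / l * (t + τ - t₁) ≤ η / 2 := by
        rw [div_mul_eq_mul_div, div_le_iff₀ hl]
        gcongr
        linarith [hτ.2]
      have := hsep t₁ t₂ (i1.trans h₁) (i1.trans h₂) (h₁₂.mono (min_le_left _ _)) _ hτ0
        (by linarith)
      refine ⟨_, _, ?_, ?_, ?_, ?_, le_trans (by linarith) this⟩
      · linarith
      · linarith
      · rw [show t₁ + (t + τ - t₁) - t = τ by ring]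
        exact hτp.mono (by linarith)
      · rw [show t₂ + (t + τ - t₁) - t = τ + -(t₁ - t₂) by ring]
        exact (hτp.add (h₁₂.mono (min_le_right _ _)).neg).mono (by linarith)

/-- Every sufficiently good almost period of `p` is eventually an `ε`-almost period of `φ`. -/
theorem SeparatesTranslates.eventually_abs_sub_lt {p : C(ℝ × ℝ, ℝ)} {K : Set ℝ} {φ : ℝ → ℝ}
    (hφ : SeparatesTranslates p K φ)
    (hp : ∀ δ : ℝ, 0 < δ → ∃ l : ℝ, 0 < l ∧ ∀ a : ℝ, ∃ τ ∈ Icc a (a + l),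
      IsAlmostPeriodOn p K δ τ)
    (hbdd : ∃ C : ℝ, ∀ t : ℝ, 0 ≤ t → |φ t| ≤ C) {ε : ℝ} (hε : 0 < ε) :
    ∃ δ : ℝ, 0 < δ ∧ ∀ τ : ℝ, IsAlmostPeriodOn p K δ τ →
      ∀ᶠ t in atTop, |φ (t + τ) - φ t| < ε := by
  obtain ⟨D, hup, hlow⟩ := exists_asymptotic_oscillation hp hbdd hφ
  obtain ⟨δ₀, hδ₀, hup⟩ := hup (ε / 5) (by positivity)
  -- it suffices to treat nonnegative almost periods
  suffices H : ∀ τ : ℝ, 0 ≤ τ → IsAlmostPeriodOn p K (δ₀ / 3) τ →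
      ∀ᶠ t in atTop, |φ (t + τ) - φ t| < ε by
    refine ⟨δ₀ / 3, by positivity, fun τ hτ => ?_⟩
    rcases le_total 0 τ with h0 | h0
    · exact H τ h0 hτ
    · filter_upwards [(tendsto_atTop_add_const_right atTop τ tendsto_id).eventually
        (H (-τ) (by linarith) hτ.neg)] with t ht
      rwa [id, add_neg_cancel_right, abs_sub_comm] at ht
  intro τ hτ0 hτ
  -- Over time `τ` the loss is at most `ε / 5`; the `+ 1` covers `τ = 0`.
  obtain ⟨δ₁, hδ₁, hsep⟩ := hφ (ε / 5 / (τ + 1)) (by positivity)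
  have hγ : ε / 5 / (τ + 1) * τ ≤ ε / 5 := by
    rw [div_mul_eq_mul_div, div_le_iff₀ (by positivity)]
    gcongr
    linarith
  set γ := ε / 5 / (τ + 1)
  have hδ : 0 < min δ₁ (δ₀ / 3) := by positivity
  filter_upwards [eventually_ge_atTop (min δ₁ (δ₀ / 3))⁻¹] with t ht
  obtain ⟨t₁, t₂, h₁, h₂, hp₁, hp₂, hosc⟩ := hlow (ε / 5) (by positivity) _ hδ t
  set δ := min δ₁ (δ₀ / 3)
  have i1 : δ₁⁻¹ ≤ δ⁻¹ := inv_anti₀ hδ (min_le_left _ _)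
  have hδ0 : δ ≤ δ₀ / 3 := min_le_right _ _
  have i0 : δ₀⁻¹ ≤ δ⁻¹ := inv_anti₀ hδ (hδ0.trans (by linarith))
  have hup' : ∀ a b, δ⁻¹ ≤ a → δ⁻¹ ≤ b → IsAlmostPeriodOn p K δ₀ (a - b) →
      φ a - φ b ≤ D + ε / 5 := fun a b ha hb => hup a b (i0.trans ha) (i0.trans hb)
  have hz : IsAlmostPeriodOn p K δ 0 := IsAlmostPeriodOn.zero hδ
  have shift : ∀ a b, IsAlmostPeriodOn p K δ (a - t) → IsAlmostPeriodOn p K δ (b - t) →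
      IsAlmostPeriodOn p K δ₀ (a + τ - b) := fun a b ha hb => by
    rw [show a + τ - b = a - t + -(b - t) + τ by ring]
    exact ((ha.add hb.neg).add hτ).mono (by linarith)
  have shift' : ∀ a b, IsAlmostPeriodOn p K δ (a - t) → IsAlmostPeriodOn p K δ (b - t) →
      IsAlmostPeriodOn p K δ₀ (b - (a + τ)) := fun a b ha hb => by
    simpa using (shift a b ha hb).neg
  have hz' : IsAlmostPeriodOn p K δ (t - t) := by simpa using hz
  rw [abs_lt]
  constructor
  -- If `φ t` is too close to `φ t₂` for separation to apply, it is already nearly minimal, and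
  -- comparing `t₁` with `t + τ` directly bounds the drop.
  · rcases le_or_gt (γ * τ) (φ t - φ t₂) with h | h
    · have e1 := hsep t t₂ (i1.trans ht) (i1.trans h₂)
        (by simpa using (hp₂.mono (min_le_left _ _)).neg) τ hτ0 h
      have e2 := hup' t₁ (t₂ + τ) h₁ (by linarith) (shift' t₂ t₁ hp₂ hp₁)
      linarith
    · have e2 := hup' t₁ (t + τ) h₁ (by linarith) (shift' t t₁ hz' hp₁)
      linarith
  · rcases le_or_gt (γ * τ) (φ t₁ - φ t) with h | h
    · have e1 := hsep t₁ t (i1.trans h₁) (i1.trans ht) (hp₁.mono (min_le_left _ _)) τ hτ0 h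
      have e2 := hup' (t₁ + τ) t₂ (by linarith) h₂ (shift t₁ t₂ hp₁ hp₂)
      linarith
    · have e2 := hup' (t + τ) t₂ (by linarith) h₂ (shift t t₂ hz' hp₂)
      linarith

theorem mainTheorem6 (T : Set ℝ) (hT : T = Set.univ ∨ T = Set.Ici 0)
    (f : C(T × ℝ, ℝ)) (hreg : PositivelyRegular f) (hmono : MonotoneInSpace f)
    (φ : ℝ → ℝ) (hφ : IsSolutionOnHalfLine f φ) (hbdd : ∃ C : ℝ, ∀ t : ℝ, 0 ≤ t → |φ t| ≤ C) :
    (AsymptoticallyInTime AlmostPeriodicInTime f → RemotelyAlmostPeriodic φ) ∧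
    (∀ τ : ℝ, 0 < τ → AsymptoticallyInTime (PeriodicInTime τ) f → RemotelyPeriodic τ φ) ∧
    (AsymptoticallyInTime StationaryInTime f → RemotelyStationary φ) := by
  have hT' : Ici 0 ⊆ T := by rcases hT with rfl | rfl <;> simp
  obtain ⟨C, hC⟩ := hbdd
  have hK : ∀ t : ℝ, 0 ≤ t → φ t ∈ Icc (-C) C := fun t ht => abs_le.1 (hC t ht)
  have periodic : ∀ p r : C(ℝ × ℝ, ℝ),
      (∀ (t : T) (x : ℝ), f (t, x) = p ((t : ℝ), x) + r ((t : ℝ), x)) →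
      (∀ K : Set ℝ, IsCompact K →
        TendstoUniformlyOn (fun t x : ℝ => r (t, x)) (fun _ => 0) atTop K) →
      AlmostPeriodicInTime p → ∀ τ : ℝ, PeriodicInTime τ p → RemotelyPeriodic τ φ := by
    intro p r hf hr hp τ hτ
    have hsep := hφ.separatesTranslates hT' hmono hK hf (hr _ isCompact_Icc)
    refine Metric.tendsto_nhds.2 fun ε hε => ?_
    obtain ⟨δ, hδ, h⟩ := hsep.eventually_abs_sub_lt (hp _ isCompact_Icc) ⟨C, hC⟩ hε
    -- An exact period is a `δ`-almost period for every `δ`, so the same `τ` serves all `ε`.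
    filter_upwards [h τ (hτ.isAlmostPeriodOn _ hδ)] with t ht
    simpa using ht
  refine ⟨?_, ?_, ?_⟩
  · rintro ⟨p, r, hf, hp, hr⟩ ε hε
    have hsep := hφ.separatesTranslates hT' hmono hK hf (hr _ isCompact_Icc)
    obtain ⟨δ, hδ, h⟩ := hsep.eventually_abs_sub_lt (hp _ isCompact_Icc) ⟨C, hC⟩ hε
    obtain ⟨l, hl, hrd⟩ := hp _ isCompact_Icc δ hδ
    refine ⟨l, hl, fun a => ?_⟩
    obtain ⟨τ, hτ, hτp⟩ := hrd a
    obtain ⟨L, hL⟩ := eventually_atTop.1 (h τ hτp)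
    exact ⟨τ, hτ, max L 1, by positivity, fun t ht => hL t ((le_max_left _ _).trans ht)⟩
  · rintro τ hτ ⟨p, r, hf, hp, hr⟩
    exact periodic p r hf hr (hp.almostPeriodicInTime hτ) τ hp
  · rintro ⟨p, r, hf, hp, hr⟩ τ
    -- The period `1` only supplies relative density; the conclusion is drawn for the arbitrary
    -- period `τ`.
    exact periodic p r hf hr ((hp 1).almostPeriodicInTime one_pos) τ (hp τ)
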